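/- Let $\alpha > 1/2$ and let $f \in C^{\alpha}(\mathbb{R},\mathbb{R})$ be a periodic function. (Here, with $\alpha = k + \beta$, $k = \lfloor \alpha \rfloor$ and $0 \le \beta < 1$, the periodic function $f$ is in $C^\alpha$ if it is $k$ times continuously differentiable and there is a constant $C$ with $|f^{(k)}(x) - f^{(k)}(y)| \le C|x-y|^{\beta}$ for all $x, y \in \mathbb{R}$.) Then there exists a number $\gamma > 0$ such that, for every $x \in \mathbb{R}$, the average $$(A_x f)(r) = \frac{1}{2r}\int_{x-r}^{x+r} f(z)\,dz, \qquad r > 0,$$ has a critical point in $r = \gamma$ (that is, it is differentiable in $r$ at $\gamma$ with derivative $0$), if and only if there are $a, b, c, d \in \mathbb{R}$ such that $$f(x) = a + b\sin(cx+d) \qquad \text{for all } x \in \mathbb{R}.$$ Moreover, there are no real $\gamma > 0$ and positive integers $m \neq n$ such that $\tan(\gamma m) = \gamma m$ and $\tan(\gamma n) = \gamma n$. -/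

import Mathlib

/-- The Hölder class `C^α(ℝ, ℝ)` for a real `α ≥ 0`: writing `α = k + β` with `k = ⌊α⌋` and
`0 ≤ β < 1`, the function is `k` times continuously differentiable and its `k`-th derivative
satisfies `|f^(k)(x) - f^(k)(y)| ≤ C |x - y|^β` for some constant `C`.
For `β = 0` the second condition says that `f^(k)` has bounded oscillation; for a periodic
function of class `C^k` it holds automatically. -/
def HolderClass (α : ℝ) (f : ℝ → ℝ) : Prop :=
  ContDiff ℝ (⌊α⌋₊ : ℕ) f ∧ MemHolder (Int.fract α).toNNReal (iteratedDeriv ⌊α⌋₊ f)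

/-- The averaging operator `(A_x f)(r) = (1 / (2 r)) ∫_{x-r}^{x+r} f(z) dz`. -/
noncomputable def averagingOp (f : ℝ → ℝ) (x r : ℝ) : ℝ :=
  1 / (2 * r) * ∫ z in (x - r)..(x + r), f z

/-- `r₀` is a critical point of `g`: the derivative of `g` at `r₀` exists and equals zero. -/
def IsCriticalPoint (g : ℝ → ℝ) (r₀ : ℝ) : Prop :=
  HasDerivAt g 0 r₀

/-! Differentiating in r, the averages are critical at γ for every x exactly when the integral of f
over [x-γ, x+γ] equals γ(f(x+γ) + f(x-γ)). Differentiating this identity in x and taking Fourier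
coefficients shows that each frequency ν of f satisfies θ cos θ = sin θ with θ = νγ, so tan θ = θ.
The frequencies are integer multiples of 2π/T, so by the tangent claim only one nonzero |ν| can
occur, and f is a shifted sine. Conversely, a positive root y of tan y = y gives γ = y/|c|.

For the tangent claim, tan(γm) = γm means e^{2iγm} = (1+iγm)/(1-iγm). Taking the n-th power of this
and the m-th power of its analogue for n eliminates the exponential. The remaining polynomial
equation is nontrivial for m ≠ n, so iγ is algebraic and e^{2iγm} is too, against Hermite–Lindemann
(`transcendental_exp_of_isAlgebraic`). -/

/-! ### The Hermite–Lindemann theorem -/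

open Polynomial in
/-- A finite set of nonzero algebraic numbers is contained in the zero set of an integer polynomial
with nonzero constant term. -/
theorem exists_int_poly_vanishing_on {K : Type*} [Field K] [Algebra ℚ K]
    [Algebra.IsAlgebraic ℚ K] (S : Finset K) (h0 : (0 : K) ∉ S) :
    ∃ f : ℤ[X], f.eval 0 ≠ 0 ∧ ∀ x ∈ S, aeval x f = 0 := by
  have key : ∀ x : K, x ∈ S → ∃ q : ℤ[X], q.coeff 0 ≠ 0 ∧ aeval x q = 0 := fun x hx ↦
    ((IsFractionRing.isAlgebraic_iff ℤ ℚ K).2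
      (Algebra.IsAlgebraic.isAlgebraic (R := ℚ) x)).exists_nonzero_coeff_and_aeval_eq_zero
      (mem_nonZeroDivisors_of_ne_zero fun h ↦ h0 (h ▸ hx))
  choose! q hq0 hq using key
  refine ⟨∏ x ∈ S, q x, ?_, fun x hx ↦ ?_⟩
  · rw [eval_prod]
    exact Finset.prod_ne_zero_iff.2 fun x hx ↦ by simpa [coeff_zero_eq_eval_zero] using hq0 x hx
  · rw [map_prod]
    exact Finset.prod_eq_zero hx (hq x hx)

open Polynomial in
/-- Multiplying by a power of the leading coefficient of `f` clears the denominators of polynomial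
expressions in a root of `f`. -/
theorem isIntegral_leadingCoeff_pow_mul_aeval {K : Type*} [Field K] (f g : ℤ[X])
    {x : K} (hx : aeval x f = 0) {k : ℕ} (hg : g.natDegree ≤ k) :
    IsIntegral ℤ ((f.leadingCoeff : K) ^ k * aeval x g) := by
  have hi : IsIntegral ℤ ((f.leadingCoeff : K) * x) := by
    simpa using isIntegral_leadingCoeff_smul f x hx
  rw [aeval_eq_sum_range' (Nat.lt_succ_of_le hg), Finset.mul_sum]
  refine IsIntegral.sum _ fun i hi' ↦ ?_
  have hik : i ≤ k := Nat.lt_succ_iff.1 (Finset.mem_range.1 hi')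
  have : (f.leadingCoeff : K) ^ k * (g.coeff i • x ^ i) =
      ((g.coeff i * f.leadingCoeff ^ (k - i) : ℤ) : K) * ((f.leadingCoeff : K) * x) ^ i := by
    rw [← Nat.sub_add_cancel hik, pow_add, zsmul_eq_mul, Nat.sub_add_cancel hik]
    push_cast
    ring
  rw [this]
  exact (isIntegral_algebraMap (R := ℤ) (A := K)).mul (hi.pow i)

/-- A Galois-invariant algebraic integer is a rational integer. -/
theorem exists_int_eq_of_isIntegral_of_fixed {K : Type*} [Field K] [Algebra ℚ K]
    [FiniteDimensional ℚ K] [IsGalois ℚ K] {y : K} (hy : IsIntegral ℤ y)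
    (hfix : ∀ σ : Gal(K/ℚ), σ y = y) : ∃ N : ℤ, y = N := by
  obtain ⟨r, rfl⟩ := IntermediateField.mem_bot.1 ((IsGalois.mem_bot_iff_fixed y).2 hfix)
  rw [isIntegral_algebraMap_iff (algebraMap ℚ K).injective,
    IsIntegrallyClosed.isIntegral_iff] at hy
  obtain ⟨N, rfl⟩ := hy
  exact ⟨N, by simp⟩

/-- Exponential growth is beaten by the factorial along some arbitrarily large prime. -/
theorem exists_prime_mul_pow_div_factorial_lt_one (B A c : ℝ) (m : ℕ) :
    ∃ p > m, p.Prime ∧ A ^ p * B * (c ^ p / (p - 1).factorial) < 1 := by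
  have h := (FloorSemiring.tendsto_pow_div_factorial_atTop (A * c)).const_mul (A * B * c)
  rw [mul_zero] at h
  obtain ⟨q, hq⟩ := Filter.eventually_atTop.1 (h.eventually_lt_const one_pos)
  obtain ⟨p, hp, hpp⟩ := Nat.exists_infinite_primes (q + m + 1)
  refine ⟨p, by omega, hpp, lt_of_eq_of_lt ?_ (hq (p - 1) (by omega))⟩
  obtain ⟨r, rfl⟩ : ∃ r, p = r + 1 := ⟨p - 1, by omega⟩
  simp only [Nat.add_sub_cancel]
  ring

open Polynomial in
/-- A Galois-invariant integer combination of exponentials of algebraic numbers with nonzero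
constant term does not vanish. -/
theorem galois_invariant_exp_sum_ne_zero {K : Type*} [Field K] [Algebra ℚ K]
    [FiniteDimensional ℚ K] [IsGalois ℚ K] (φ : K →+* ℂ) (S : Finset K) (b : K → ℤ) (b₀ : ℤ)
    (hb₀ : b₀ ≠ 0) (h0 : (0 : K) ∉ S) (hS : ∀ σ : Gal(K/ℚ), ∀ x ∈ S, σ x ∈ S)
    (hb : ∀ (σ : Gal(K/ℚ)) (x : K), b (σ x) = b x) :
    (b₀ : ℂ) + ∑ x ∈ S, b x * Complex.exp (φ x) ≠ 0 := by
  intro hsum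
  obtain ⟨f, hf0, hf⟩ := exists_int_poly_vanishing_on S h0
  have hfne : f ≠ 0 := by rintro rfl; simp at hf0
  obtain ⟨c, hc⟩ := LindemannWeierstrass.exp_polynomial_approx f hf0
  set a := f.leadingCoeff with ha
  have hane : a ≠ 0 := leadingCoeff_ne_zero.2 hfne
  -- Being larger than |f(0)|, |a| and |b₀|, the prime p divides none of them.
  obtain ⟨p, hpm, hpp, hlt⟩ := exists_prime_mul_pow_div_factorial_lt_one
    (∑ x ∈ S, |(b x : ℝ)|) (|(a : ℝ)| ^ f.natDegree) c
    ((eval 0 f).natAbs + a.natAbs + b₀.natAbs)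
  obtain ⟨n, hpn, g, hg, happrox⟩ := hc p (by omega) hpp
  set k := p * f.natDegree with hk
  have hroot : ∀ x ∈ S, φ x ∈ f.aroots ℂ := fun x hx ↦ by
    rw [mem_aroots]
    refine ⟨hfne, ?_⟩
    have := congrArg φ (hf x hx)
    rwa [map_zero, map_aeval_eq_aeval_map (φ := RingHom.id ℤ) (RingHom.ext_int _ _), Polynomial.map_id] at this
  have hφg : ∀ x, aeval (φ x) g = φ (aeval x g) := fun x ↦ by
    rw [map_aeval_eq_aeval_map (φ := RingHom.id ℤ) (RingHom.ext_int _ _), Polynomial.map_id]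
  obtain ⟨N, hN⟩ : ∃ N : ℤ, (∑ x ∈ S, (b x : K) * ((a : K) ^ k * aeval x g)) = N := by
    refine exists_int_eq_of_isIntegral_of_fixed ?_ fun σ ↦ ?_
    · exact IsIntegral.sum _ fun x hx ↦ (isIntegral_algebraMap (R := ℤ) (A := K)).mul
        (isIntegral_leadingCoeff_pow_mul_aeval f g (hf x hx) (hg.trans (Nat.sub_le _ _)))
    · have hσ : ∀ x, σ (aeval x g) = aeval (σ x) g := fun x ↦
        (aeval_algHom_apply (σ.toAlgHom.restrictScalars ℤ) x g).symm
      rw [map_sum]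
      refine Finset.sum_bij (fun x _ ↦ σ x) (fun x hx ↦ hS σ x hx)
        (fun _ _ _ _ h ↦ σ.injective h)
        (fun y hy ↦ ⟨σ⁻¹ y, hS _ y hy, σ.apply_symm_apply y⟩) fun x _ ↦ ?_
      simp [hσ, hb]
  have hNC := congrArg φ hN
  simp only [map_sum, map_mul, map_pow, map_intCast, ← hφg] at hNC
  -- The vanishing sum trades n * b₀ for exponentials, leaving an integer made only of Hermite
  -- approximation errors. It has absolute value below 1, hence is 0, and reducing mod p gives the
  -- contradiction.
  have hident : ((a ^ k * n * b₀ + p * N : ℤ) : ℂ) =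
      -∑ x ∈ S, (a : ℂ) ^ k * ((b x : ℂ) * (n • Complex.exp (φ x) - p • aeval (φ x) g)) := by
    have h1 : (a : ℂ) ^ k * n * b₀ = -∑ x ∈ S, (a : ℂ) ^ k * (b x * (n * Complex.exp (φ x))) := by
      rw [eq_neg_of_add_eq_zero_left hsum, mul_neg, Finset.mul_sum]
      congr 1
      exact Finset.sum_congr rfl fun x _ ↦ by ring
    push_cast
    rw [h1, ← hNC, Finset.mul_sum, ← sub_eq_zero, sub_neg_eq_add, add_assoc,
      ← Finset.sum_add_distrib, neg_add_eq_zero]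
    exact Finset.sum_congr rfl fun x _ ↦ by simp; ring
  have hnorm : ‖((a ^ k * n * b₀ + p * N : ℤ) : ℂ)‖ < 1 := by
    rw [hident, norm_neg]
    refine (norm_sum_le _ _).trans_lt (lt_of_le_of_lt ?_ hlt)
    rw [Finset.mul_sum, Finset.sum_mul]
    refine Finset.sum_le_sum fun x hx ↦ ?_
    rw [norm_mul, norm_mul, norm_pow, Complex.norm_intCast, Complex.norm_intCast, ← pow_mul,
      mul_comm f.natDegree, ← hk, mul_assoc]
    gcongr
    exact happrox (hroot x hx)
  have hzero : a ^ k * n * b₀ + p * N = 0 := by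
    rw [Complex.norm_intCast] at hnorm
    exact Int.abs_lt_one_iff.1 (by exact_mod_cast hnorm)
  have hdvd : (p : ℤ) ∣ a ^ k * n * b₀ :=
    (Int.dvd_add_left (dvd_mul_right _ _)).1 (hzero ▸ dvd_zero _)
  have hsmall : ∀ z : ℤ, z ≠ 0 → z.natAbs < p → ¬ (p : ℤ) ∣ z := fun z hz hzp h ↦
    absurd (Nat.le_of_dvd (Int.natAbs_pos.2 hz) (Int.natCast_dvd.1 h)) (by omega)
  have hprime := Nat.prime_iff_prime_int.1 hpp
  rcases hprime.dvd_or_dvd hdvd with h | h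
  · rcases hprime.dvd_or_dvd h with h | h
    · exact hsmall a hane (by omega) (hprime.dvd_of_dvd_pow h)
    · exact hpn h
  · exact hsmall b₀ hb₀ (by omega) h

/-- A Galois-invariant multiple with nonzero constant coefficient of a nonzero element of the
group ring `ℤ[K]`. -/
theorem exists_galois_invariant_multiple {K : Type*} [Field K] [Algebra ℚ K]
    [FiniteDimensional ℚ K] {F : AddMonoidAlgebra ℤ K} (hF : F ≠ 0) :
    ∃ H : AddMonoidAlgebra ℤ K, F ∣ H ∧ H.coeff 0 ≠ 0 ∧
      ∀ (σ : Gal(K/ℚ)) (x : K), H.coeff (σ x) = H.coeff x := by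
  classical
  let act : Gal(K/ℚ) → AddMonoidAlgebra ℤ K ≃+* AddMonoidAlgebra ℤ K := fun σ ↦
    AddMonoidAlgebra.mapDomainRingEquiv ℤ (σ : K ≃+ K)
  have hcoeff : ∀ σ x (y : K), (act σ x).coeff y = x.coeff (σ⁻¹ y) := fun σ x y ↦ by
    simp only [act, AddMonoidAlgebra.coeff_mapDomainRingEquiv, Finsupp.equivMapDomain_apply]
    rfl
  have hmul : ∀ σ τ x, act σ (act τ x) = act (σ * τ) x := fun σ τ x ↦ by
    ext y
    simp [hcoeff]
  have hone : ∀ x, act 1 x = x := fun x ↦ by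
    ext y
    simp [hcoeff]
  have hcoeff_of_inv : ∀ x, (∀ σ, act σ x = x) →
      ∀ (σ : Gal(K/ℚ)) (y : K), x.coeff (σ y) = x.coeff y := fun x hx σ y ↦ by
    conv_lhs => rw [← hx σ, hcoeff]
    simp
  set P := ∏ σ : Gal(K/ℚ), act σ F with hP
  have hPne : P ≠ 0 := Finset.prod_ne_zero_iff.2 fun σ _ ↦ (map_ne_zero_iff _ (act σ).injective).2 hF
  have hPinv : ∀ σ, act σ P = P := fun σ ↦ by
    rw [hP, map_prod]
    simp only [hmul]
    exact Fintype.prod_equiv (Equiv.mulLeft σ) _ _ fun τ ↦ rfl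
  obtain ⟨x₀, hx₀⟩ : ∃ x₀, P.coeff x₀ ≠ 0 := by
    by_contra! h
    exact hPne (by ext y; simp [h y])
  -- By invariance P has the same coefficient at every σ x₀, so each term of Q adds P(x₀) to the
  -- constant coefficient of P * Q, with no cancellation.
  let Q : AddMonoidAlgebra ℤ K := ∑ σ : Gal(K/ℚ), AddMonoidAlgebra.single (-σ x₀) 1
  have hQinv : ∀ σ, act σ Q = Q := fun σ ↦ by
    simp only [Q, map_sum]
    refine Fintype.sum_equiv (Equiv.mulLeft σ) _ _ fun τ ↦ ?_
    simp [act]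
    rfl
  refine ⟨P * Q, ?_, ?_, hcoeff_of_inv _ fun σ ↦ by rw [map_mul, hPinv, hQinv]⟩
  · refine Dvd.dvd.mul_right ?_ _
    have := Finset.dvd_prod_of_mem (fun σ ↦ act σ F) (Finset.mem_univ (1 : Gal(K/ℚ)))
    simpa only [hone] using this
  · have : (P * Q).coeff 0 = ∑ σ : Gal(K/ℚ), P.coeff x₀ := by
      simp only [Q, Finset.mul_sum, AddMonoidAlgebra.coeff_sum, Finsupp.finsetSum_apply]
      refine Finset.sum_congr rfl fun σ _ ↦ ?_
      rw [AddMonoidAlgebra.coeff_mul_single_apply]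
      simp [hcoeff_of_inv P hPinv]
    rw [this]
    simp [hx₀]

/-- The Hermite–Lindemann theorem: `exp a` is transcendental for algebraic `a ≠ 0`. -/
theorem transcendental_exp_of_isAlgebraic {a : ℂ} (ha : IsAlgebraic ℚ a) (ha0 : a ≠ 0) :
    Transcendental ℤ (Complex.exp a) := by
  intro hexp
  obtain ⟨q, hq0, hq⟩ := hexp
  let m := minpoly ℚ a
  let K := IntermediateField.adjoin ℚ (m.rootSet ℂ)
  have hmne : m ≠ 0 := minpoly.ne_zero ha.isIntegral
  have : m.IsSplittingField ℚ K :=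
    IntermediateField.adjoin_rootSet_isSplittingField (IsAlgClosed.splits _)
  have : FiniteDimensional ℚ K := Polynomial.IsSplittingField.finiteDimensional K m
  have : IsGalois ℚ K :=
    IsGalois.of_separable_splitting_field (minpoly.irreducible ha.isIntegral).separable
  let φ : K →+* ℂ := algebraMap K ℂ
  obtain ⟨α, hα⟩ : ∃ α : K, φ α = a :=
    ⟨⟨a, IntermediateField.subset_adjoin ℚ _
      ((Polynomial.mem_rootSet).2 ⟨hmne, minpoly.aeval ℚ a⟩)⟩, rfl⟩
  have hα0 : α ≠ 0 := by rintro rfl; exact ha0 (by rw [← hα, map_zero])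
  let E : Multiplicative K →* ℂ :=
    { toFun := fun x ↦ Complex.exp (φ x.toAdd)
      map_one' := by simp
      map_mul' := fun x y ↦ by simp [Complex.exp_add] }
  let ev := AddMonoidAlgebra.lift ℤ ℂ K E
  have hev1 : ev (AddMonoidAlgebra.single α 1) = Complex.exp a := by simp [ev, E, hα]
  let F : AddMonoidAlgebra ℤ K := Polynomial.aeval (AddMonoidAlgebra.single α 1) q
  have hevF : ev F = 0 := by
    simp only [F]
    rw [← Polynomial.aeval_algHom_apply, hev1, hq]
  -- The multiples i • α are distinct, so the leading coefficient of q survives in F.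
  have hF : F ≠ 0 := by
    intro h
    have h1 : F.coeff (q.natDegree • α) = q.leadingCoeff := by
      simp only [F, Polynomial.aeval_eq_sum_range, AddMonoidAlgebra.single_pow, one_pow,
        AddMonoidAlgebra.coeff_sum, Finsupp.finsetSum_apply]
      rw [Finset.sum_eq_single_of_mem q.natDegree (by simp)]
      · simp
      · intro i _ hi
        have : i • α ≠ q.natDegree • α := fun h ↦ hi (by simpa [hα0] using h)
        simp [this.symm, -nsmul_eq_mul]
    rw [h] at h1
    exact hq0 (Polynomial.leadingCoeff_eq_zero.1 (by simpa using h1.symm))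
  obtain ⟨H, ⟨G, hHG⟩, hH0, hHinv⟩ := exists_galois_invariant_multiple hF
  have hevH : ev H = 0 := by rw [hHG, map_mul, hevF, zero_mul]
  classical
  refine galois_invariant_exp_sum_ne_zero φ (H.coeff.support.erase 0) H.coeff (H.coeff 0) hH0
    (by simp) (fun σ x hx ↦ ?_) hHinv ?_
  · simpa [hHinv] using hx
  · have h2 := hevH
    simp only [ev, AddMonoidAlgebra.lift_apply, Finsupp.sum] at h2
    rw [← Finset.add_sum_erase _ _ (Finsupp.mem_support_iff.2 hH0)] at h2
    simpa [E] using h2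

/-! ### Fixed points of the tangent -/

theorem cos_ne_zero_of_tan_eq_self {y : ℝ} (hy : y ≠ 0) (h : Real.tan y = y) : Real.cos y ≠ 0 := by
  intro hc
  rw [Real.tan_eq_sin_div_cos, hc, div_zero] at h
  exact hy h.symm

theorem exp_two_mul_I_of_tan_eq_self {y : ℝ} (hy : y ≠ 0) (h : Real.tan y = y) :
    Complex.exp (2 * (Complex.I * y)) * (1 - Complex.I * y) = 1 + Complex.I * y := by
  have hc := cos_ne_zero_of_tan_eq_self hy h
  have hs : Real.sin y = y * Real.cos y := by
    rw [Real.tan_eq_sin_div_cos, div_eq_iff hc] at h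
    exact h
  have hsC : Complex.sin y = y * Complex.cos y := by exact_mod_cast congrArg Complex.ofReal hs
  have h2 := Complex.sin_sq_add_cos_sq (y : ℂ)
  rw [two_mul, Complex.exp_add, mul_comm Complex.I, Complex.exp_mul_I]
  rw [hsC] at h2 ⊢
  linear_combination (1 + y * Complex.I) * h2 -
    (1 + y * Complex.I) * Complex.cos y ^ 2 * y ^ 2 * Complex.I_sq

theorem one_sub_I_mul_ofReal_ne_zero (y : ℝ) : 1 - Complex.I * (y : ℂ) ≠ 0 := fun h ↦ by
  have := congrArg Complex.re h
  simp at this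

open Polynomial in
theorem isAlgebraic_of_pow_mul_pow_eq {z : ℂ} {m n : ℕ} (hm : 0 < m) (hn : 0 < n) (hmn : m ≠ n)
    (h : (1 + m * z) ^ n * (1 - n * z) ^ m = (1 - m * z) ^ n * (1 + n * z) ^ m) :
    IsAlgebraic ℚ z := by
  refine ⟨(1 + (m : ℚ[X]) * X) ^ n * (1 - (n : ℚ[X]) * X) ^ m -
    (1 - (m : ℚ[X]) * X) ^ n * (1 + (n : ℚ[X]) * X) ^ m, fun h0 ↦ ?_, by simp [h]⟩
  have hm' : (m : ℚ) ≠ 0 := by positivity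
  -- At 1/m the second product vanishes while the first is 2^n (1 - n/m)^m ≠ 0.
  have h1 := congrArg (eval (1 / (m : ℚ))) h0
  simp only [eval_sub, eval_mul, eval_pow, eval_add, eval_one, eval_natCast, eval_X, eval_zero,
    mul_one_div_cancel hm', sub_self] at h1
  rw [zero_pow hn.ne', zero_mul, sub_zero] at h1
  have h2 : (1 : ℚ) - n * (1 / m) ≠ 0 := fun h ↦ hmn (by
      field_simp at h
      rw [mul_zero, sub_eq_zero] at h
      exact_mod_cast h)
  exact mul_ne_zero (by norm_num) (pow_ne_zero m h2) h1

/-- Distinct positive integer multiples of a number cannot both be fixed points of the tangent. -/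
theorem not_exists_two_tan_fixed_points :
    ¬ ∃ (γ : ℝ) (m n : ℕ), 0 < γ ∧ 0 < m ∧ 0 < n ∧ m ≠ n ∧
      Real.tan (γ * m) = γ * m ∧ Real.tan (γ * n) = γ * n := by
  rintro ⟨γ, m, n, hγ, hm, hn, hmn, htm, htn⟩
  have hem := exp_two_mul_I_of_tan_eq_self (by positivity) htm
  have hen := exp_two_mul_I_of_tan_eq_self (by positivity) htn
  have hne := one_sub_I_mul_ofReal_ne_zero (γ * m)
  set z : ℂ := Complex.I * γ with hz
  have hzm : Complex.I * ((γ * m : ℝ) : ℂ) = m * z := by push_cast; rw [hz]; ring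
  have hzn : Complex.I * ((γ * n : ℝ) : ℂ) = n * z := by push_cast; rw [hz]; ring
  rw [hzm] at hem hne
  rw [hzn] at hen
  have hexp : Complex.exp (2 * (m * z)) ^ n = Complex.exp (2 * (n * z)) ^ m := by
    rw [← Complex.exp_nat_mul, ← Complex.exp_nat_mul]
    ring_nf
  have hz_alg : IsAlgebraic ℚ z := isAlgebraic_of_pow_mul_pow_eq hm hn hmn (by
    rw [← hem, ← hen, mul_pow, mul_pow, hexp]
    ring)
  have hmz : IsAlgebraic ℚ ((m : ℂ) * z) := (isAlgebraic_natCast m).mul hz_alg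
  have hval : Complex.exp (2 * (m * z)) = (1 + m * z) / (1 - m * z) := eq_div_of_mul_eq hne hem
  refine transcendental_exp_of_isAlgebraic (a := 2 * (m * z)) ((isAlgebraic_natCast 2).mul hmz) ?_ ?_
  · simp [hz, hm.ne', hγ.ne']
  · rw [IsFractionRing.isAlgebraic_iff ℤ ℚ ℂ, hval, div_eq_mul_inv]
    exact (isAlgebraic_one.add hmz).mul (isAlgebraic_one.sub hmz).inv

/-! ### Critical points of averages, and the sine case -/

theorem hasDerivAt_integral_sub_add {f : ℝ → ℝ} (hf : Continuous f) (x r : ℝ) :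
    HasDerivAt (fun r ↦ ∫ z in (x - r)..(x + r), f z) (f (x + r) + f (x - r)) r := by
  have hF : ∀ y, HasDerivAt (fun y ↦ ∫ z in (0 : ℝ)..y, f z) (f y) y := fun y ↦
    intervalIntegral.integral_hasDerivAt_right (hf.intervalIntegrable _ _)
      (hf.stronglyMeasurableAtFilter _ _) hf.continuousAt
  have h1 := (hF (x + r)).comp r ((hasDerivAt_id' r).const_add x)
  have h2 := (hF (x - r)).comp r ((hasDerivAt_id' r).const_sub x)
  have h3 := h1.sub h2
  refine (h3.congr_deriv (by ring)).congr_of_eventuallyEq (Filter.Eventually.of_forall fun s ↦ ?_)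
  exact (intervalIntegral.integral_interval_sub_left (hf.intervalIntegrable _ _)
    (hf.intervalIntegrable _ _)).symm

/-- Criticality of the average at `γ` in terms of the integral mean. -/
theorem isCriticalPoint_averagingOp_iff {f : ℝ → ℝ} (hf : Continuous f) (x : ℝ) {γ : ℝ}
    (hγ : 0 < γ) : IsCriticalPoint (averagingOp f x) γ ↔
      ∫ z in (x - γ)..(x + γ), f z = γ * (f (x + γ) + f (x - γ)) := by
  have h1 : HasDerivAt (fun r : ℝ ↦ 1 / (2 * r)) (-(1 / (2 * γ ^ 2))) γ := by
    have := (hasDerivAt_inv hγ.ne').const_mul (1 / 2 : ℝ)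
    refine (this.congr_deriv (by field_simp)).congr_of_eventuallyEq
      (Filter.Eventually.of_forall fun s ↦ ?_)
    simp [mul_comm]
  have h : HasDerivAt (averagingOp f x) _ γ := h1.mul (hasDerivAt_integral_sub_add hf x γ)
  constructor
  · intro hcrit
    have := h.unique hcrit
    field_simp at this
    linarith
  · intro heq
    refine h.congr_deriv ?_
    rw [heq]
    field_simp
    ring

theorem exists_pos_sin_eq_mul_cos : ∃ y : ℝ, 0 < y ∧ Real.sin y = y * Real.cos y := by
  have hπ := Real.pi_pos
  -- The function is π at π and -2π at 2π.
  obtain ⟨y, hy, h⟩ := intermediate_value_Icc' (show Real.pi ≤ 2 * Real.pi by linarith)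
    (f := fun y ↦ Real.sin y - y * Real.cos y) (by fun_prop)
    (show (0 : ℝ) ∈ Set.Icc _ _ by simp [hπ.le])
  exact ⟨y, by linarith [hy.1], sub_eq_zero.1 h⟩

/-- The averages of `a + b sin (c x + d)` have a common critical point. -/
theorem exists_isCriticalPoint_of_sin (a b c d : ℝ) :
    ∃ γ : ℝ, 0 < γ ∧ ∀ x : ℝ,
      IsCriticalPoint (averagingOp (fun x ↦ a + b * Real.sin (c * x + d)) x) γ := by
  have hcont : Continuous fun x ↦ a + b * Real.sin (c * x + d) := by fun_prop
  obtain ⟨y, hy, hsc⟩ := exists_pos_sin_eq_mul_cos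
  rcases eq_or_ne c 0 with rfl | hc
  · refine ⟨1, one_pos, fun x ↦ ?_⟩
    rw [isCriticalPoint_averagingOp_iff hcont x one_pos]
    simp
    ring
  have hγ : 0 < y / |c| := by positivity
  refine ⟨y / |c|, hγ, fun x ↦ ?_⟩
  rw [isCriticalPoint_averagingOp_iff hcont x hγ]
  set γ := y / |c|
  have hcγ : Real.sin (c * γ) = c * γ * Real.cos (c * γ) := by
    rcases abs_cases c with ⟨h, -⟩ | ⟨h, -⟩
    · have : c * γ = y := by simp only [γ, h]; field_simp
      rw [this, hsc]
    · have : c * γ = -y := by simp only [γ, h]; field_simp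
      rw [this, Real.sin_neg, Real.cos_neg, hsc]
      ring
  have hprim : ∀ t, HasDerivAt (fun t ↦ a * t - b / c * Real.cos (c * t + d))
      (a + b * Real.sin (c * t + d)) t := fun t ↦ by
    have h1 := (((hasDerivAt_id' t).const_mul c).add_const d).cos.const_mul (b / c)
    have h2 := ((hasDerivAt_id' t).const_mul a).sub h1
    refine h2.congr_deriv ?_
    field_simp
    ring
  rw [intervalIntegral.integral_eq_sub_of_hasDerivAt (fun t _ ↦ hprim t)
    (hcont.intervalIntegrable _ _)]
  have e1 : c * (x + γ) + d = (c * x + d) + c * γ := by ring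
  have e2 : c * (x - γ) + d = (c * x + d) - c * γ := by ring
  rw [e1, e2]
  generalize c * x + d = u
  rw [Real.cos_add, Real.cos_sub, Real.sin_add, Real.sin_sub, hcγ]
  field_simp
  ring

/-! ### Fourier coefficients and the allowed frequencies -/

theorem integral_exp_mul_comp_add {g : ℝ → ℂ} {T : ℝ} (hg : Function.Periodic g T) {μ : ℂ}
    (hμ : Complex.exp (μ * T) = 1) (s : ℝ) :
    ∫ x in (0 : ℝ)..T, Complex.exp (-(μ * x)) * g (x + s) =
      Complex.exp (μ * s) * ∫ x in (0 : ℝ)..T, Complex.exp (-(μ * x)) * g x := by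
  have hG : Function.Periodic (fun x : ℝ ↦ Complex.exp (-(μ * x)) * g x) T := fun x ↦ by
    dsimp only
    rw [hg x, Complex.ofReal_add, mul_add, neg_add, Complex.exp_add, Complex.exp_neg (μ * T), hμ,
      inv_one, mul_one]
  have h1 : ∀ x : ℝ, Complex.exp (-(μ * x)) * g (x + s) = Complex.exp (μ * s) *
      (fun x : ℝ ↦ Complex.exp (-(μ * x)) * g x) (x + s) := fun x ↦ by
    dsimp only
    rw [← mul_assoc, ← Complex.exp_add]
    congr 2
    push_cast
    ring
  simp_rw [h1]
  rw [intervalIntegral.integral_const_mul,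
    intervalIntegral.integral_comp_add_right (fun x : ℝ ↦ Complex.exp (-(μ * x)) * g x) s,
    zero_add, add_comm T s, hG.intervalIntegral_add_eq s 0, zero_add]

/-- Integration by parts; the boundary terms cancel by periodicity. -/
theorem integral_exp_mul_deriv {h h' : ℝ → ℂ} {T : ℝ} (hh : Function.Periodic h T)
    (hd : ∀ x, HasDerivAt h (h' x) x) (hc : Continuous h') {μ : ℂ}
    (hμ : Complex.exp (μ * T) = 1) :
    ∫ x in (0 : ℝ)..T, Complex.exp (-(μ * x)) * h' x =
      μ * ∫ x in (0 : ℝ)..T, Complex.exp (-(μ * x)) * h x := by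
  have hhc : Continuous h := continuous_iff_continuousAt.2 fun x ↦ (hd x).continuousAt
  have he : ∀ x : ℝ, HasDerivAt (fun x : ℝ ↦ Complex.exp (-(μ * x)))
      (-(μ * Complex.exp (-(μ * x)))) x := fun x ↦ by
    have := ((hasDerivAt_id' x).ofReal_comp.const_mul μ).neg.cexp
    refine this.congr_deriv ?_
    simp
    ring
  have hzero := intervalIntegral.integral_eq_sub_of_hasDerivAt (a := 0) (b := T)
    (fun x _ ↦ (he x).mul (hd x)) (Continuous.intervalIntegrable (by fun_prop) _ _)
  have hT : h T = h 0 := by simpa using hh 0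
  rw [intervalIntegral.integral_add (Continuous.intervalIntegrable (by fun_prop) _ _)
    (Continuous.intervalIntegrable (by fun_prop) _ _)] at hzero
  simp only [Pi.mul_apply, Complex.ofReal_zero, mul_zero, neg_zero, Complex.exp_zero, hT,
    Complex.exp_neg (μ * T), hμ, inv_one, sub_self, neg_mul, mul_assoc,
    intervalIntegral.integral_neg, intervalIntegral.integral_const_mul] at hzero
  linear_combination hzero

/-- Through the mean identity this makes f(x+γ) + f(x-γ) differentiable in x, although f is only
continuous. -/
theorem hasDerivAt_integral_add_sub {f : ℝ → ℝ} (hf : Continuous f) (γ x : ℝ) :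
    HasDerivAt (fun x ↦ ∫ z in (x - γ)..(x + γ), f z) (f (x + γ) - f (x - γ)) x := by
  have hF : ∀ y, HasDerivAt (fun y ↦ ∫ z in (0 : ℝ)..y, f z) (f y) y := fun y ↦
    intervalIntegral.integral_hasDerivAt_right (hf.intervalIntegrable _ _)
      (hf.stronglyMeasurableAtFilter _ _) hf.continuousAt
  have h1 := (hF (x + γ)).comp x ((hasDerivAt_id' x).add_const γ)
  have h2 := (hF (x - γ)).comp x ((hasDerivAt_id' x).sub_const γ)
  refine ((h1.sub h2).congr_deriv (by ring)).congr_of_eventuallyEq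
    (Filter.Eventually.of_forall fun s ↦ ?_)
  exact (intervalIntegral.integral_interval_sub_left (hf.intervalIntegrable _ _)
    (hf.intervalIntegrable _ _)).symm

/-- The frequencies `θ / γ` of a periodic function whose averages over intervals of radius `γ`
equal the averages over the endpoints satisfy `θ cos θ = sin θ`. -/
theorem mul_cos_eq_sin_of_integral_exp_mul_ne_zero {f : ℝ → ℝ} (hf : Continuous f) {T γ : ℝ}
    (hT : Function.Periodic f T)
    (hcrit : ∀ x, ∫ z in (x - γ)..(x + γ), f z = γ * (f (x + γ) + f (x - γ))) {ν : ℝ}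
    (hν : Complex.exp (ν * Complex.I * T) = 1)
    (hne : ∫ x in (0 : ℝ)..T, Complex.exp (-(ν * Complex.I * x)) * (f x : ℂ) ≠ 0) :
    ν * γ * Real.cos (ν * γ) = Real.sin (ν * γ) := by
  set μ : ℂ := ν * Complex.I with hμ
  let g : ℝ → ℂ := fun x ↦ f x
  have hg : Function.Periodic g T := fun x ↦ by simp [g, hT x]
  have hgc : Continuous g := Complex.continuous_ofReal.comp hf
  let h : ℝ → ℂ := fun x ↦ γ * (g (x + γ) + g (x + -γ))
  have hh : Function.Periodic h T := fun x ↦ by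
    simp only [h, add_right_comm x T, hg _]
  have hd : ∀ x, HasDerivAt h (g (x + γ) - g (x + -γ)) x := fun x ↦ by
    have h1 := (hasDerivAt_integral_add_sub hf γ x).ofReal_comp
    refine (h1.congr_deriv (by simp [g, sub_eq_add_neg])).congr_of_eventuallyEq
      (Filter.Eventually.of_forall fun s ↦ ?_)
    simp only [hcrit]
    simp [h, g, sub_eq_add_neg]
  have key := integral_exp_mul_deriv hh hd (by fun_prop) hν
  have hI : ∀ s : ℝ, IntervalIntegrable (fun x : ℝ ↦ Complex.exp (-(μ * x)) * g (x + s))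
      MeasureTheory.volume 0 T := fun s ↦ Continuous.intervalIntegrable (by fun_prop) _ _
  have hL : ∫ x in (0 : ℝ)..T, Complex.exp (-(μ * x)) * (g (x + γ) - g (x + -γ)) =
      (Complex.exp (μ * γ) - Complex.exp (-(μ * γ))) *
        ∫ x in (0 : ℝ)..T, Complex.exp (-(μ * x)) * g x := by
    simp_rw [mul_sub]
    rw [intervalIntegral.integral_sub (hI _) (hI _), integral_exp_mul_comp_add hg hν,
      integral_exp_mul_comp_add hg hν]
    push_cast
    ring_nf
  have hR : ∫ x in (0 : ℝ)..T, Complex.exp (-(μ * x)) * h x =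
      γ * (Complex.exp (μ * γ) + Complex.exp (-(μ * γ))) *
        ∫ x in (0 : ℝ)..T, Complex.exp (-(μ * x)) * g x := by
    have hx : ∀ x : ℝ, Complex.exp (-(μ * x)) * h x = γ *
        (Complex.exp (-(μ * x)) * g (x + γ) + Complex.exp (-(μ * x)) * g (x + -γ)) := fun x ↦ by
      simp only [h]
      ring
    simp_rw [hx]
    rw [intervalIntegral.integral_const_mul, intervalIntegral.integral_add (hI _) (hI _),
      integral_exp_mul_comp_add hg hν, integral_exp_mul_comp_add hg hν]
    push_cast
    ring_nf
  rw [hL, hR, ← mul_assoc] at key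
  have key2 := mul_right_cancel₀ hne key
  have e1 : μ * γ = ((ν * γ : ℝ) : ℂ) * Complex.I := by rw [hμ]; push_cast; ring
  rw [e1, ← neg_mul, Complex.exp_mul_I, Complex.exp_mul_I, Complex.cos_neg, Complex.sin_neg,
    ← Complex.ofReal_cos, ← Complex.ofReal_sin, hμ] at key2
  generalize Real.cos (ν * γ) = C at key2 ⊢
  generalize Real.sin (ν * γ) = S at key2 ⊢
  have key3 := congrArg Complex.im key2
  simp at key3
  linarith

/-- A real trigonometric polynomial with a single frequency is a shifted sine. -/
theorem exists_sin_eq_cos_add_sin (B C : ℝ) :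
    ∃ b d : ℝ, ∀ θ : ℝ, B * Real.cos θ + C * Real.sin θ = b * Real.sin (θ + d) := by
  refine ⟨‖(⟨C, B⟩ : ℂ)‖, Complex.arg ⟨C, B⟩, fun θ ↦ ?_⟩
  rw [Real.sin_add]
  have h1 := Complex.norm_mul_cos_arg ⟨C, B⟩
  have h2 := Complex.norm_mul_sin_arg ⟨C, B⟩
  simp only at h1 h2
  linear_combination -Real.sin θ * h1 - Real.cos θ * h2

/-- A continuous real `T`-periodic function whose nonzero frequencies all have the same absolute
value is a shifted sine. -/
theorem eq_sin_of_fourier_supported {f : ℝ → ℝ} (hf : Continuous f) {T : ℝ} (hT0 : 0 < T)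
    (hT : Function.Periodic f T) (k : ℕ) (hk : 0 < k)
    (hsupp : ∀ n : ℤ, n ≠ 0 → n.natAbs ≠ k →
      ∫ x in (0 : ℝ)..T, Complex.exp (-(2 * Real.pi * n / T * Complex.I * x)) * (f x : ℂ) = 0) :
    ∃ a b c d : ℝ, ∀ x : ℝ, f x = a + b * Real.sin (c * x + d) := by
  have : Fact (0 < T) := ⟨hT0⟩
  have hg : Function.Periodic (fun x ↦ (f x : ℂ)) T := fun x ↦ by simp [hT x]
  let F : C(AddCircle T, ℂ) := ⟨hg.lift,
    (QuotientAddGroup.isQuotientMap_mk _).continuous_iff.2 (Complex.continuous_ofReal.comp hf)⟩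
  have hF : ∀ x : ℝ, F (x : AddCircle T) = f x := fun x ↦ hg.lift_coe x
  have hzero : ∀ n : ℤ, n ∉ ({0, (k : ℤ), -(k : ℤ)} : Finset ℤ) → fourierCoeff F n = 0 := by
    intro n hn
    simp only [Finset.mem_insert, Finset.mem_singleton, not_or] at hn
    rw [fourierCoeff_eq_intervalIntegral F n 0, zero_add]
    simp_rw [fourier_coe_apply, hF, smul_eq_mul]
    rw [smul_eq_zero]
    right
    rw [← hsupp n hn.1 (by omega)]
    congr 1
    ext x
    congr 2
    push_cast
    ring
  -- Finite support makes the Fourier series converge to F at every point; its real part is then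
  -- read off.
  have hsum : Summable (fourierCoeff F) := summable_of_ne_finset_zero hzero
  set p := fourierCoeff F k
  set q := fourierCoeff F (-(k : ℤ))
  obtain ⟨b, d, hbd⟩ := exists_sin_eq_cos_add_sin (p.re + q.re) (q.im - p.im)
  refine ⟨(fourierCoeff F 0).re, b, 2 * Real.pi * k / T, d, fun x ↦ ?_⟩
  have h1 := (has_pointwise_sum_fourier_series_of_summable hsum (x : AddCircle T)).unique
    (hasSum_sum_of_ne_finset_zero fun n hn ↦ by rw [hzero n hn, zero_smul])
  rw [Finset.sum_insert (by simp; omega), Finset.sum_insert (by simp; omega),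
    Finset.sum_singleton, hF, fourier_coe_apply, fourier_coe_apply, fourier_coe_apply] at h1
  have e1 : 2 * (Real.pi : ℂ) * Complex.I * (k : ℤ) * x / T =
      ((2 * Real.pi * k / T * x : ℝ) : ℂ) * Complex.I := by push_cast; ring
  have e2 : 2 * (Real.pi : ℂ) * Complex.I * (-(k : ℤ) : ℤ) * x / T =
      -((2 * Real.pi * k / T * x : ℝ) : ℂ) * Complex.I := by push_cast; ring
  rw [e1, e2, Complex.exp_mul_I, Complex.exp_mul_I, Complex.cos_neg, Complex.sin_neg,
    ← Complex.ofReal_cos, ← Complex.ofReal_sin] at h1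
  rw [← hbd]
  generalize Real.cos (2 * Real.pi * k / T * x) = C at h1 ⊢
  generalize Real.sin (2 * Real.pi * k / T * x) = S at h1 ⊢
  have h2 := congrArg Complex.re h1
  simp at h2
  rw [h2]
  ring

/-- A periodic continuous function whose averages have a common critical point is a shifted
sine. -/
theorem eq_sin_of_isCriticalPoint {f : ℝ → ℝ} (hf : Continuous f) {T γ : ℝ} (hT0 : 0 < T)
    (hT : Function.Periodic f T) (hγ : 0 < γ)
    (hcrit : ∀ x, IsCriticalPoint (averagingOp f x) γ) :
    ∃ a b c d : ℝ, ∀ x : ℝ, f x = a + b * Real.sin (c * x + d) := by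
  have hmean := fun x ↦ (isCriticalPoint_averagingOp_iff hf x hγ).1 (hcrit x)
  let ω : ℝ := 2 * Real.pi * γ / T
  have hω : 0 < ω := by positivity
  let I : ℤ → ℂ := fun n ↦
    ∫ x in (0 : ℝ)..T, Complex.exp (-(2 * Real.pi * n / T * Complex.I * x)) * (f x : ℂ)
  have htan : ∀ n : ℤ, n ≠ 0 → I n ≠ 0 → Real.tan (ω * n.natAbs) = ω * n.natAbs := by
    intro n hn hI
    have hperiod : Complex.exp (((2 * Real.pi * n / T : ℝ) : ℂ) * Complex.I * T) = 1 := by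
      rw [Complex.exp_eq_one_iff]
      refine ⟨n, ?_⟩
      have : (T : ℂ) ≠ 0 := by exact_mod_cast hT0.ne'
      push_cast
      field_simp
    have h := mul_cos_eq_sin_of_integral_exp_mul_ne_zero hf hT hmean hperiod
      (by push_cast; exact hI)
    have harg : 2 * Real.pi * n / T * γ = ω * n := by simp only [ω]; ring
    rw [harg] at h
    have hcos : Real.cos (ω * n) ≠ 0 := fun h0 ↦ by
      have := Real.sin_sq_add_cos_sq (ω * n)
      rw [← h, h0] at this
      norm_num at this
    have ht : Real.tan (ω * n) = ω * n := by
      rw [Real.tan_eq_sin_div_cos, ← h, mul_div_assoc, div_self hcos, mul_one]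
    rw [Nat.cast_natAbs, Int.cast_abs]
    rcases abs_cases (n : ℝ) with ⟨h, -⟩ | ⟨h, -⟩
    · rw [h, ht]
    · rw [h, mul_neg, Real.tan_neg, ht]
  by_cases hex : ∃ n : ℤ, n ≠ 0 ∧ I n ≠ 0
  · obtain ⟨n, hn, hIn⟩ := hex
    refine eq_sin_of_fourier_supported hf hT0 hT n.natAbs (by omega) fun m hm hmn ↦ ?_
    by_contra hIm
    exact not_exists_two_tan_fixed_points ⟨ω, m.natAbs, n.natAbs, hω, by omega, by omega, hmn,
      htan m hm hIm, htan n hn hIn⟩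
  -- With no nonzero frequency, any k > 0 serves.
  · push Not at hex
    exact eq_sin_of_fourier_supported hf hT0 hT 1 one_pos fun m hm _ ↦ hex m hm

theorem theorem1 :
    (∀ (α : ℝ) (f : ℝ → ℝ), 1 / 2 < α → HolderClass α f →
      (∃ T : ℝ, 0 < T ∧ Function.Periodic f T) →
      ((∃ γ : ℝ, 0 < γ ∧ ∀ x : ℝ, IsCriticalPoint (averagingOp f x) γ) ↔
        ∃ a b c d : ℝ, ∀ x : ℝ, f x = a + b * Real.sin (c * x + d))) ∧
    (¬ ∃ (γ : ℝ) (m n : ℕ), 0 < γ ∧ 0 < m ∧ 0 < n ∧ m ≠ n ∧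
      Real.tan (γ * m) = γ * m ∧ Real.tan (γ * n) = γ * n) := by
  refine ⟨fun α f _ hf ⟨T, hT0, hT⟩ ↦ ⟨fun ⟨γ, hγ, hcrit⟩ ↦ ?_, ?_⟩,
    not_exists_two_tan_fixed_points⟩
  · exact eq_sin_of_isCriticalPoint hf.1.continuous hT0 hT hγ hcrit
  · rintro ⟨a, b, c, d, h⟩
    rw [show f = fun x ↦ a + b * Real.sin (c * x + d) from funext h]
    exact exists_isCriticalPoint_of_sin a b c d
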